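/- Let $p\colon E\to B$ be a (Hurewicz) fibration, i.e. a continuous map with the homotopy lifting property with respect to all topological spaces. Let $I=[0,1]$. For a singular $k$-simplex $\sigma\colon\Delta^k\to B$ write $\sigma=\langle 0,1,\dots,k\rangle$, let $F_i=p^{-1}(\sigma(i))$ be the fibre over the image of the $i$-th vertex, let $\partial_j\sigma=\langle 0,\dots,j-1,j+1,\dots,k\rangle$ be the $j$-th face of $\sigma$, and let $\langle 0,\dots,j\rangle$ and $\langle j,\dots,k\rangle$ be the restrictions of $\sigma$ to the front and back faces of $\Delta^k$ spanned by these vertices. Then there is a representation up to homotopy of the singular simplicial set $\mathrm{Sing}(B)$ on $E$; that is, there is a collection of continuous maps $$\theta_k(\sigma)\colon I^{k-1}\times F_0\to F_k ,$$ one for each $k\ge 0$ and each singular $k$-simplex $\sigma$ of $B$ (for $k=0$ there is no parameter and $\theta_0(\sigma)\colon F_0\to F_0$), such that: 1. $\theta_0(\sigma)$ is the identity of $F_0$ for every $0$-simplex $\sigma$; 2. for every $\sigma$ and every fixed $(t_1,\dots,t_{k-1})\in I^{k-1}$, the map $\theta_k(\sigma)(t_1,\dots,t_{k-1},-)\colon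 F_0\to F_k$ is a homotopy equivalence; 3. for $1\le j\le k-1$ and $e\in F_0$, if $t_j=0$ then $$\theta_k(\sigma)(t_1,\dots,t_{k-1},e)=\theta_{k-1}(\partial_j\sigma)(t_1,\dots,t_{j-1},t_{j+1},\dots,t_{k-1},e);$$ 4. for $1\le j\le k-1$ and $e\in F_0$, if $t_j=1$ then $$\theta_k(\sigma)(t_1,\dots,t_{k-1},e)=\theta_{k-j}(\langle j,\dots,k\rangle)\bigl(t_{j+1},\dots,t_{k-1},\ \theta_j(\langle 0,\dots,j\rangle)(t_1,\dots,t_{j-1},e)\bigr).$$ -/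

import Mathlib

universe u v

/-- `p : E → B` is a (Hurewicz) fibration: it has the homotopy lifting property with respect to
every topological space `X`. (All spaces of the universe `max u v`, which contains copies of all
spaces of the universes of `E` and of `B`.) -/
def IsHurewiczFibration {E : Type u} {B : Type v} [TopologicalSpace E] [TopologicalSpace B]
    (p : C(E, B)) : Prop :=
  ∀ (X : Type (max u v)) [TopologicalSpace X] (f : C(X, E)) (H : C(X × unitInterval, B)),
    (∀ x, H (x, 0) = p (f x)) →
      ∃ K : C(X × unitInterval, E), (∀ x, K (x, 0) = f x) ∧ ∀ z, p (K z) = H z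

/-- A continuous map is a homotopy equivalence if it has a homotopy inverse. -/
def IsHomotopyEquivalence {X : Type u} {Y : Type v} [TopologicalSpace X] [TopologicalSpace Y]
    (f : C(X, Y)) : Prop :=
  ∃ h : ContinuousMap.HomotopyEquiv X Y, h.toFun = f

/-- The fibre of `p` over `b`, with the subspace topology. -/
abbrev Fibre {E : Type u} {B : Type v} [TopologicalSpace E] [TopologicalSpace B]
    (p : C(E, B)) (b : B) : Type u :=
  {e : E // p e = b}

/-- The same point, regarded in the fibre over an equal base point. -/
def Fibre.cast {E : Type u} {B : Type v} [TopologicalSpace E] [TopologicalSpace B]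
    {p : C(E, B)} {b c : B} (h : b = c) (e : Fibre p b) : Fibre p c :=
  ⟨e.1, e.2.trans h⟩

/-- The singular `k`-simplices `σ : Δ^k → B`, i.e. the `k`-simplices of `Sing(B)`. -/
abbrev SingSimplex (B : Type v) [TopologicalSpace B] (k : ℕ) : Type v :=
  C(stdSimplex ℝ (Fin (k + 1)), B)

namespace SingSimplex

variable {B : Type v} [TopologicalSpace B]

/-- The vertex `i` of the singular simplex `σ`, a point of `B`. -/
noncomputable def vertex {k : ℕ} (σ : SingSimplex B k) (i : Fin (k + 1)) : B :=
  σ (stdSimplex.vertex i)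

/-- The singular simplex `⟨f 0, …, f m⟩` of `σ = ⟨0, …, k⟩`: the composite of `σ` with the affine
map `Δ^m → Δ^k` that sends the vertex `i` to the vertex `f i`. -/
noncomputable def restrict {k m : ℕ} (σ : SingSimplex B k) (f : Fin (m + 1) → Fin (k + 1)) :
    SingSimplex B m :=
  ContinuousMap.comp σ ⟨stdSimplex.map f, stdSimplex.continuous_map f⟩

theorem vertex_restrict {k m : ℕ} (σ : SingSimplex B k) (f : Fin (m + 1) → Fin (k + 1))
    (i : Fin (m + 1)) : (σ.restrict f).vertex i = σ.vertex (f i) := by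
  simp [restrict, vertex, stdSimplex.map_vertex]

/-- The face `∂_i σ = ⟨0, …, i - 1, i + 1, …, k + 1⟩` of a `(k + 1)`-simplex. -/
noncomputable def face {k : ℕ} (σ : SingSimplex B (k + 1)) (i : Fin (k + 2)) : SingSimplex B k :=
  σ.restrict i.succAbove

/-- The front face `⟨0, …, p⟩` of a `(p + q)`-simplex. -/
noncomputable def front (p q : ℕ) (σ : SingSimplex B (p + q)) : SingSimplex B p :=
  σ.restrict (Fin.castLE (by omega))

/-- The back face `⟨p, …, p + q⟩` of a `(p + q)`-simplex. -/
noncomputable def back (p q : ℕ) (σ : SingSimplex B (p + q)) : SingSimplex B q :=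
  σ.restrict (fun i : Fin (q + 1) => (Fin.natAdd p i : Fin (p + q + 1)))

theorem vertex_zero_face {k : ℕ} (σ : SingSimplex B (k + 1)) (j : Fin (k + 1)) :
    σ.vertex 0 = (σ.face j.succ).vertex 0 := by
  rw [face, vertex_restrict, Fin.succAbove_ne_zero_zero (Fin.succ_ne_zero j)]

theorem vertex_zero_front (p q : ℕ) (σ : SingSimplex B (p + q)) :
    σ.vertex 0 = (σ.front p q).vertex 0 := by
  rw [front, vertex_restrict]; rfl

theorem vertex_last_front (p q : ℕ) (σ : SingSimplex B (p + q)) :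
    (σ.front p q).vertex (Fin.last p) = (σ.back p q).vertex 0 := by
  rw [front, back, vertex_restrict, vertex_restrict]; rfl

end SingSimplex

/-- A representation up to homotopy of `Sing(B)` on `p : E → B`. Here `F_i` is the fibre over the
vertex `i` of `σ`, and the cube `I^(k-1)` is `Fin (k - 1) → unitInterval`, so that the coordinate
which is usually called `t_j` (`1 ≤ j ≤ k - 1`) has the index `j - 1`; for `k = 0`, where there is no
parameter, the cube is a point. -/
structure RepUpToHomotopy {E : Type u} {B : Type v} [TopologicalSpace E] [TopologicalSpace B]
    (p : C(E, B)) where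
  /-- The maps `θ_k(σ) : I^(k-1) × F_0 → F_k`. -/
  θ : ∀ (k : ℕ) (σ : SingSimplex B k),
    C((Fin (k - 1) → unitInterval) × Fibre p (σ.vertex 0), Fibre p (σ.vertex (Fin.last k)))
  /-- `θ_0` is the identity of `F_0`. -/
  θ_zero : ∀ (σ : SingSimplex B 0) (t : Fin (0 - 1) → unitInterval) (e : Fibre p (σ.vertex 0)),
    θ 0 σ (t, e) = e
  /-- For fixed parameters, `θ_k(σ)(t, -) : F_0 → F_k` is a homotopy equivalence. -/
  homotopyEquivalence : ∀ (k : ℕ) (σ : SingSimplex B k) (t : Fin (k - 1) → unitInterval),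
    IsHomotopyEquivalence ((θ k σ).curry t)
  /-- Face relations. With `k = n + 2` and `j + 1` in `{1, …, k - 1}`: if the coordinate
  `t_(j+1)` is `0` and the other ones are `s`, then `θ_k(σ)(t, e) = θ_(k-1)(∂_(j+1) σ)(s, e)`. -/
  face_rel : ∀ (n : ℕ) (σ : SingSimplex B (n + 2)) (j : Fin (n + 1)) (s : Fin n → unitInterval)
    (e : Fibre p (σ.vertex 0)),
    (θ (n + 2) σ (j.insertNth (α := fun _ => unitInterval) 0 s, e) : E) =
      θ (n + 1) (σ.face j.castSucc.succ) (s, e.cast (σ.vertex_zero_face j.castSucc))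
  /-- Composition relations. With `a + 1` and `b + 1` for the dimensions of the front and of the
  back face, so that `k = (a + 1) + (b + 1)`: if `t = (s, 1, u)`, where the coordinate
  `t_(a+1)` is `1`, then `θ_k(σ)(t, -)` is `θ_(a+1)⟨0, …, a + 1⟩(s, -)` followed by
  `θ_(b+1)⟨a + 1, …, k⟩(u, -)`. -/
  comp_rel : ∀ (a b : ℕ) (σ : SingSimplex B ((a + 1) + (b + 1)))
    (s : Fin a → unitInterval) (u : Fin b → unitInterval)
    (e : Fibre p (σ.vertex 0)),
    (θ ((a + 1) + (b + 1)) σ (Fin.append (Fin.snoc (α := fun _ => unitInterval) s 1) u, e) : E) =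
      θ (b + 1) (σ.back (a + 1) (b + 1))
        (u, (θ (a + 1) (σ.front (a + 1) (b + 1))
          (s, e.cast (σ.vertex_zero_front (a + 1) (b + 1)))).cast
            (σ.vertex_last_front (a + 1) (b + 1)))

/-! A fibration admits a lifting function: a choice of end points of lifts, continuous in the path,
the initial point and the running time D, and trivial for D = 0. This gives transport between
fibres. Running a transport only part of the way and then back contracts the round trip to the
identity, so transports are homotopy equivalences.

It remains to choose, continuously in the parameters, a path in the simplex from the first to the
last vertex and times at which its lift is restarted. Write τ_i = t_(i+1), continued by 1, and v_i =
τ_0 + ... + τ_(i-1). The sum of the barycentric coordinates with index at least i + 1 climbs from 0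
to 1 on [v_i, v_i + 1]. If τ_i = 0, the sums for i + 1 and i + 2 agree, so the path lies in the face
opposite to the vertex i + 1. If τ_i = 1, the first sum is complete when the second starts, so the
path passes through the vertex i + 1 at the time v_(i+1).

The restart times are r_0 = 0 and r_(i+1) = (1 - τ_i) r_i + τ_i v_(i+1). For τ_i = 0 the step from
r_i to r_(i+1) has length zero and disappears, which gives the face relation
(`simplexTransport_face`). For τ_i = 1 the lift is restarted exactly at the vertex i + 1, so the
chain of transports splits there (`simplexTransport_comp`). -/

section Transport

/-! ### Lifting functions and transport between fibres -/

variable {E : Type u} {B : Type v} [TopologicalSpace E] [TopologicalSpace B] {p : C(E, B)}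

/-- A point `e` of `E`, a path in `B` that is at `p e` at the time `0`, and a time. -/
abbrev LiftingProblem (p : C(E, B)) : Type (max u v) :=
  {w : E × C(ℝ, B) × ℝ // p w.1 = w.2.1 0}

/-- A continuous choice of the end point of a lift of `γ`, run from the time `0` to the time `D`
(which may be negative), with a prescribed initial point. The lift is trivial if `D = 0`. -/
structure EndpointLifting (p : C(E, B)) where
  lift : LiftingProblem p → E
  continuous_lift : Continuous lift
  proj_lift : ∀ w, p (lift w) = w.1.2.1 w.1.2.2
  lift_zero : ∀ w, w.1.2.2 = 0 → lift w = w.1.1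

/-- The homotopy lifting property is applied to the space of all lifting problems at once. Lifts of
constant paths need not be constant; the lift is therefore read off at a parameter that depends on D
and is 0 for D = 0. -/
theorem IsHurewiczFibration.nonempty_endpointLifting (hp : IsHurewiczFibration p) :
    Nonempty (EndpointLifting p) := by
  -- This is D clamped to [-s(1 + |D|), s(1 + |D|)]: it starts at 0 and reaches D at s = |D| / (1 +
  -- |D|). The summand 1 keeps the quotient continuous at D = 0.
  let time : LiftingProblem p × unitInterval → ℝ := fun z =>
    max (-((z.2 : ℝ) * (1 + |z.1.1.2.2|))) (min ((z.2 : ℝ) * (1 + |z.1.1.2.2|)) z.1.1.2.2)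
  have htime : Continuous time := by fun_prop
  let H : C(LiftingProblem p × unitInterval, B) := ⟨fun z => z.1.1.2.1 (time z), by fun_prop⟩
  obtain ⟨K, hK0, hK⟩ := hp (LiftingProblem p) ⟨fun w => w.1.1, by fun_prop⟩ H (by
    intro w
    change w.1.2.1 (time (w, 0)) = p w.1.1
    have : time (w, 0) = 0 := by
      rcases le_total 0 w.1.2.2 with h | h <;> simp [time, h]
    rw [this, w.2])
  have hpos : ∀ D : ℝ, 0 < 1 + |D| := fun D => by positivity
  let s : LiftingProblem p → unitInterval := fun w => ⟨|w.1.2.2| / (1 + |w.1.2.2|), by positivity,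
    (div_le_one (hpos _)).2 (by linarith)⟩
  have hs : Continuous s := by
    refine Continuous.subtype_mk ?_ _
    exact Continuous.div (by fun_prop) (by fun_prop) fun w => (hpos _).ne'
  refine ⟨⟨fun w => K (w, s w), by fun_prop, fun w => ?_, fun w hw => ?_⟩⟩
  · rw [hK]
    change w.1.2.1 (time (w, s w)) = _
    have : time (w, s w) = w.1.2.2 := by
      have h : (s w : ℝ) * (1 + |w.1.2.2|) = |w.1.2.2| := div_mul_cancel₀ _ (hpos _).ne'
      simp only [time, h]
      rw [min_eq_right (le_abs_self _), max_eq_right (neg_abs_le _)]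
    rw [this]
  · have : s w = 0 := Subtype.ext (by simp [s, hw])
    simp only [this]
    exact hK0 w

/-- The path `γ` run from the time `a` on, and stopped outside of the interval between `a` and
`a + D`. -/
def stoppedPath (γ : C(ℝ, B)) (a D : ℝ) : C(ℝ, B) :=
  ⟨fun x => γ (a + max (min 0 D) (min x (max 0 D))), by fun_prop⟩

theorem stoppedPath_zero (γ : C(ℝ, B)) (a D : ℝ) : stoppedPath γ a D 0 = γ a := by
  rcases le_total 0 D with h | h <;> simp [stoppedPath, h]

theorem stoppedPath_end (γ : C(ℝ, B)) (a D : ℝ) : stoppedPath γ a D D = γ (a + D) := by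
  rcases le_total 0 D with h | h <;> simp [stoppedPath, h]

theorem stoppedPath_congr {γ γ' : C(ℝ, B)} {a a' D : ℝ}
    (h : ∀ x ∈ Set.uIcc 0 D, γ (a + x) = γ' (a' + x)) :
    stoppedPath γ a D = stoppedPath γ' a' D := by
  ext x
  refine h _ ?_
  rcases le_total 0 D with h | h <;> simp [h]

theorem continuous_stoppedPath {Z : Type*} [TopologicalSpace Z] {γ : Z → C(ℝ, B)} {a D : Z → ℝ}
    (hγ : Continuous γ) (ha : Continuous a) (hD : Continuous D) :
    Continuous fun z => stoppedPath (γ z) (a z) (D z) := by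
  refine ContinuousMap.continuous_of_continuous_uncurry _ ?_
  change Continuous fun y : Z × ℝ =>
    γ y.1 (a y.1 + max (min 0 (D y.1)) (min y.2 (max 0 (D y.1))))
  fun_prop

namespace EndpointLifting

variable (L : EndpointLifting p)

open Classical in
/-- The transport of `e` along `γ` from the time `a` to the time `b`; the value is meaningful
if `e` lies over `γ a`. -/
noncomputable def transport (γ : C(ℝ, B)) (a b : ℝ) (e : E) : E :=
  if h : p e = γ a then
    L.lift ⟨(e, stoppedPath γ a (b - a), b - a), h.trans (stoppedPath_zero γ a _).symm⟩
  else e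

theorem proj_transport {γ : C(ℝ, B)} {a : ℝ} (b : ℝ) {e : E} (h : p e = γ a) :
    p (L.transport γ a b e) = γ b := by
  rw [transport, dif_pos h, L.proj_lift, stoppedPath_end, add_sub_cancel]

theorem transport_self (γ : C(ℝ, B)) (a : ℝ) (e : E) : L.transport γ a a e = e := by
  unfold transport
  split_ifs
  · exact L.lift_zero _ (sub_self a)
  · rfl

/-- Only the stopped path enters the lift, so transport depends on nothing but the segment
traversed, up to translation of time. -/
theorem transport_congr {γ γ' : C(ℝ, B)} {a b a' b' : ℝ} (hD : b - a = b' - a')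
    (h : ∀ x ∈ Set.uIcc 0 (b - a), γ (a + x) = γ' (a' + x)) (e : E) :
    L.transport γ a b e = L.transport γ' a' b' e := by
  have h0 : γ a = γ' a' := by simpa using h 0 Set.left_mem_uIcc
  by_cases he : p e = γ a
  · simp only [transport, dif_pos he, dif_pos (he.trans h0), ← hD, stoppedPath_congr h]
  · rw [transport, transport, dif_neg he, dif_neg (h0 ▸ he)]

theorem continuous_transport {Z : Type*} [TopologicalSpace Z] {γ : Z → C(ℝ, B)} {a b : Z → ℝ}
    {e : Z → E} (hγ : Continuous γ) (ha : Continuous a) (hb : Continuous b) (he : Continuous e)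
    (h : ∀ z, p (e z) = γ z (a z)) :
    Continuous fun z => L.transport (γ z) (a z) (b z) (e z) := by
  have hz : ∀ z, L.transport (γ z) (a z) (b z) (e z) =
      L.lift ⟨(e z, stoppedPath (γ z) (a z) (b z - a z), b z - a z),
        (h z).trans (stoppedPath_zero (γ z) (a z) _).symm⟩ := fun z => dif_pos (h z)
  simp only [hz]
  exact L.continuous_lift.comp (Continuous.subtype_mk
    (he.prodMk ((continuous_stoppedPath hγ ha (hb.sub ha)).prodMk (hb.sub ha))) _)

/-- The transport between the fibres over `γ a` and over `γ b`. -/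
noncomputable def fibreTransport (γ : C(ℝ, B)) (a b : ℝ) :
    C(Fibre p (γ a), Fibre p (γ b)) :=
  ⟨fun e => ⟨L.transport γ a b e.1, L.proj_transport b e.2⟩,
    Continuous.subtype_mk (L.continuous_transport continuous_const continuous_const
      continuous_const continuous_subtype_val fun e => e.2) _⟩

/-- The homotopy goes from a to a + s(b - a) and back; at s = 0 both transports are trivial. -/
theorem fibreTransport_comp_homotopic (γ : C(ℝ, B)) (a b : ℝ) :
    ((L.fibreTransport γ b a).comp (L.fibreTransport γ a b)).Homotopic (ContinuousMap.id _) := by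
  refine ContinuousMap.Homotopic.symm ⟨⟨⟨fun z => ⟨L.transport γ (a + z.1 * (b - a)) a
    (L.transport γ a (a + z.1 * (b - a)) z.2.1), L.proj_transport _ (L.proj_transport _ z.2.2)⟩,
    ?_⟩, fun e => ?_, fun e => ?_⟩⟩
  · refine Continuous.subtype_mk (L.continuous_transport continuous_const (by fun_prop)
      continuous_const (L.continuous_transport continuous_const continuous_const (by fun_prop)
        (by fun_prop) fun z => z.2.2) fun z => L.proj_transport _ z.2.2) _
  · apply Subtype.ext
    simp [transport_self]
  · apply Subtype.ext
    simp [fibreTransport]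

theorem isHomotopyEquivalence_fibreTransport (γ : C(ℝ, B)) (a b : ℝ) :
    IsHomotopyEquivalence (L.fibreTransport γ a b) :=
  ⟨⟨_, L.fibreTransport γ b a, L.fibreTransport_comp_homotopic γ a b,
    L.fibreTransport_comp_homotopic γ b a⟩, rfl⟩

/-- The successive transports along `γ` between the times `c 0, …, c n`. -/
noncomputable def chain (γ : C(ℝ, B)) (c : ℕ → ℝ) : ℕ → E → E
  | 0, e => e
  | n + 1, e => L.transport γ (c n) (c (n + 1)) (chain γ c n e)

theorem proj_chain {γ : C(ℝ, B)} {c : ℕ → ℝ} {e : E} (h : p e = γ (c 0)) :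
    ∀ n, p (L.chain γ c n e) = γ (c n)
  | 0 => h
  | n + 1 => L.proj_transport _ (proj_chain h n)

theorem continuous_chain {Z : Type*} [TopologicalSpace Z] {γ : Z → C(ℝ, B)} {c : Z → ℕ → ℝ}
    {e : Z → E} (hγ : Continuous γ) (hc : ∀ i, Continuous fun z => c z i) (he : Continuous e)
    (h : ∀ z, p (e z) = γ z (c z 0)) :
    ∀ n, Continuous fun z => L.chain (γ z) (c z) n (e z)
  | 0 => he
  | n + 1 => L.continuous_transport hγ (hc _) (hc _) (continuous_chain hγ hc he h n)
      fun z => L.proj_chain (h z) n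

theorem chain_congr {γ γ' : C(ℝ, B)} {c c' : ℕ → ℝ} (e : E) (n : ℕ)
    (hc : ∀ i < n, c (i + 1) - c i = c' (i + 1) - c' i)
    (h : ∀ i < n, ∀ x ∈ Set.uIcc 0 (c (i + 1) - c i), γ (c i + x) = γ' (c' i + x)) :
    L.chain γ c n e = L.chain γ' c' n e := by
  induction n with
  | zero => rfl
  | succ n ih =>
    rw [chain, chain, ih (fun i hi => hc i (by omega)) (fun i hi => h i (by omega))]
    exact L.transport_congr (hc n (by omega)) (h n (by omega)) _

theorem chain_add (γ : C(ℝ, B)) (c : ℕ → ℝ) (m n : ℕ) (e : E) :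
    L.chain γ c (m + n) e = L.chain γ (fun i => c (m + i)) n (L.chain γ c m e) := by
  induction n with
  | zero => rfl
  | succ n ih => rw [← add_assoc, chain, chain, ih]; rfl

/-- The hypotheses force c j = c (j + 1), and the transport over this step of length zero is the
identity. -/
theorem chain_skip (γ : C(ℝ, B)) {c c' : ℕ → ℝ} {j : ℕ} (h₁ : ∀ i ≤ j, c i = c' i)
    (h₂ : ∀ i, j ≤ i → c (i + 1) = c' i) (e : E) (n : ℕ) (hn : j ≤ n) :
    L.chain γ c (n + 1) e = L.chain γ c' n e := by
  induction n, hn using Nat.le_induction with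
  | base =>
    rw [chain, h₂ j le_rfl, h₁ j le_rfl, transport_self]
    refine L.chain_congr e j (fun i hi => ?_) (fun i hi x _ => ?_)
    · rw [h₁ i hi.le, h₁ (i + 1) hi]
    · rw [h₁ i hi.le]
  | succ n hn ih => rw [chain, ih, h₂ n hn, h₂ (n + 1) (by omega), chain]

/-- The successive transports as a map between the fibres at both ends. -/
noncomputable def fibreChain (γ : C(ℝ, B)) (c : ℕ → ℝ) (n : ℕ) {x y : B} (hx : x = γ (c 0))
    (hy : γ (c n) = y) : C(Fibre p x, Fibre p y) :=
  ⟨fun e => ⟨L.chain γ c n e.1, (L.proj_chain (e.2.trans hx) n).trans hy⟩,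
    Continuous.subtype_mk (L.continuous_chain (γ := fun _ => γ) (c := fun _ => c)
      continuous_const (fun _ => continuous_const) continuous_subtype_val
      (fun e : Fibre p x => e.2.trans hx) n) _⟩

theorem isHomotopyEquivalence_fibreChain (γ : C(ℝ, B)) (c : ℕ → ℝ) (n : ℕ) {x y : B}
    (hx : x = γ (c 0)) (hy : γ (c n) = y) :
    IsHomotopyEquivalence (L.fibreChain γ c n hx hy) := by
  subst hx hy
  induction n with
  | zero => exact ⟨ContinuousMap.HomotopyEquiv.refl _, rfl⟩
  | succ n ih =>
    obtain ⟨f, hf⟩ := ih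
    obtain ⟨g, hg⟩ := L.isHomotopyEquivalence_fibreTransport γ (c n) (c (n + 1))
    refine ⟨f.trans g, ?_⟩
    change g.toFun.comp f.toFun = _
    rw [hf, hg]
    rfl

end EndpointLifting

end Transport

/-! ### Paths in the standard simplex and restart times -/

section SimplexPath

/-- The coordinates of `y` on the range of `f` already sum to 1, so the nonnegative others vanish.
Comparing paths in a face and in the simplex thus needs only the coordinates of the face. -/
theorem stdSimplex_map_eq_of_injective {m k : ℕ} {f : Fin m → Fin k} (hf : f.Injective)
    (x : stdSimplex ℝ (Fin m)) (y : stdSimplex ℝ (Fin k)) (h : ∀ i, y (f i) = x i) :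
    stdSimplex.map f x = y := by
  have hy : ∀ j, j ∉ Set.range f → y j = 0 := by
    intro j hj
    have h₁ : ∑ i ∈ Finset.univ.image f, y i = 1 := by
      rw [Finset.sum_image fun _ _ _ _ hab => hf hab]
      simp only [h]
      exact x.2.2
    have h₂ : ∑ i ∈ insert j (Finset.univ.image f), y i ≤ ∑ i, y i :=
      Finset.sum_le_sum_of_subset_of_nonneg (Finset.subset_univ _) fun i _ _ => y.2.1 i
    rw [Finset.sum_insert (by simpa using hj), h₁,
      show ∑ i, y i = 1 from y.2.2] at h₂
    exact le_antisymm (by linarith) (y.2.1 j)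
  ext j
  rw [stdSimplex.map_coe, FunOnFinite.linearMap_apply_apply]
  by_cases hj : j ∈ Set.range f
  · obtain ⟨i, rfl⟩ := hj
    rw [Finset.sum_eq_single i]
    · exact (h i).symm
    · intro b hb hbi
      exact absurd (hf (by simpa using hb)) hbi
    · simp
  · rw [hy j hj]
    refine Finset.sum_eq_zero fun i hi => absurd ⟨i, by simpa using hi⟩ hj

/-- The time at which the path with the parameters `τ` passes the vertex `i`, if `τ (i - 1) = 1`. -/
noncomputable def vertexTime (τ : ℕ → unitInterval) (i : ℕ) : ℝ := ∑ l ∈ Finset.range i, (τ l : ℝ)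

theorem vertexTime_zero (τ : ℕ → unitInterval) : vertexTime τ 0 = 0 := by simp [vertexTime]

theorem vertexTime_succ (τ : ℕ → unitInterval) (i : ℕ) : vertexTime τ (i + 1) =
    vertexTime τ i + τ i :=
  Finset.sum_range_succ _ _

theorem vertexTime_mono (τ : ℕ → unitInterval) : Monotone (vertexTime τ) :=
  monotone_nat_of_le_succ fun i => by rw [vertexTime_succ]; linarith [(τ i).2.1]

/-- The times at which the lift is restarted. -/
noncomputable def restartTime (τ : ℕ → unitInterval) : ℕ → ℝ
  | 0 => 0
  | i + 1 => restartTime τ i + τ i * (vertexTime τ (i + 1) - restartTime τ i)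

/-- Each new restart time is a convex combination of the previous one and of the next vertex time.
-/
theorem restartTime_le_vertexTime (τ : ℕ → unitInterval) : ∀ i, restartTime τ i ≤ vertexTime τ i
  | 0 => by simp [restartTime, vertexTime]
  | i + 1 => by
    have h := (restartTime_le_vertexTime τ i).trans (vertexTime_mono τ i.le_succ)
    rw [restartTime]
    nlinarith [(τ i).2.1, (τ i).2.2]

theorem restartTime_mono (τ : ℕ → unitInterval) : Monotone (restartTime τ) :=
  monotone_nat_of_le_succ fun i => by
    have h := (restartTime_le_vertexTime τ i).trans (vertexTime_mono τ i.le_succ)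
    rw [restartTime]
    nlinarith [(τ i).2.1]

theorem restartTime_succ_of_one {τ : ℕ → unitInterval} {i : ℕ} (h : τ i = 1) :
    restartTime τ (i + 1) = vertexTime τ (i + 1) := by
  rw [restartTime, h]; simp

theorem continuous_vertexTime (i : ℕ) : Continuous fun τ : ℕ → unitInterval => vertexTime τ i := by
  unfold vertexTime; fun_prop

theorem continuous_restartTime : ∀ i, Continuous fun τ : ℕ → unitInterval => restartTime τ i
  | 0 => continuous_const
  | i + 1 => by
    have := continuous_restartTime i
    have := continuous_vertexTime (i + 1)
    simp only [restartTime]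
    fun_prop

/-- The sum of the barycentric coordinates with indices at least `i` at the time `x`. -/
noncomputable def cumulativeCoord (τ : ℕ → unitInterval) (x : ℝ) : ℕ → ℝ
  | 0 => 1
  | i + 1 => max 0 (min (x - vertexTime τ i) 1)

theorem cumulativeCoord_nonneg (τ : ℕ → unitInterval) (x : ℝ) : ∀ i, 0 ≤ cumulativeCoord τ x i
  | 0 => zero_le_one
  | _ + 1 => le_max_left _ _

theorem cumulativeCoord_antitone (τ : ℕ → unitInterval) (x : ℝ) : Antitone (cumulativeCoord τ x) :=
  antitone_nat_of_succ_le fun i => by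
    cases i with
    | zero => exact max_le zero_le_one (min_le_right _ _)
    | succ i =>
      have := vertexTime_mono τ i.le_succ
      simp only [cumulativeCoord]
      gcongr

/-- The barycentric coordinate `i` at the time `x` of the path in the `k`-simplex. -/
noncomputable def pathCoord (k : ℕ) (τ : ℕ → unitInterval) (x : ℝ) (i : ℕ) : ℝ :=
  cumulativeCoord τ x i - if i < k then cumulativeCoord τ x (i + 1) else 0

theorem sum_pathCoord (k : ℕ) (τ : ℕ → unitInterval) (x : ℝ) :
    ∑ i : Fin (k + 1), pathCoord k τ x i = 1 := by
  rw [Fin.sum_univ_eq_sum_range, Finset.sum_range_succ]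
  have : ∑ i ∈ Finset.range k, pathCoord k τ x i = 1 - cumulativeCoord τ x k := by
    rw [Finset.sum_congr rfl fun i hi => by rw [pathCoord, if_pos (Finset.mem_range.1 hi)],
      Finset.sum_range_sub']
    rfl
  rw [this, pathCoord, if_neg (lt_irrefl k)]
  ring

/-- The path with the parameters `τ` from the first to the last vertex of the `k`-simplex. -/
noncomputable def simplexPoint (k : ℕ) (τ : ℕ → unitInterval) (x : ℝ) :
    stdSimplex ℝ (Fin (k + 1)) :=
  ⟨fun i => pathCoord k τ x i, fun i => by
    change 0 ≤ pathCoord k τ x i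
    rw [pathCoord]
    split_ifs
    · exact sub_nonneg.2 (cumulativeCoord_antitone τ x (Nat.le_succ _))
    · simpa using cumulativeCoord_nonneg τ x i, sum_pathCoord k τ x⟩

theorem simplexPoint_apply (k : ℕ) (τ : ℕ → unitInterval) (x : ℝ) (i : Fin (k + 1)) :
    simplexPoint k τ x i = pathCoord k τ x i := rfl

theorem continuous_cumulativeCoord (i : ℕ) :
    Continuous fun z : (ℕ → unitInterval) × ℝ => cumulativeCoord z.1 z.2 i := by
  cases i with
  | zero => exact continuous_const
  | succ i =>
    have := continuous_vertexTime i
    simp only [cumulativeCoord]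
    fun_prop

theorem continuous_simplexPoint (k : ℕ) :
    Continuous fun z : (ℕ → unitInterval) × ℝ => simplexPoint k z.1 z.2 := by
  refine Continuous.subtype_mk (continuous_pi fun i => ?_) _
  have := continuous_cumulativeCoord i
  have := continuous_cumulativeCoord (i + 1)
  unfold pathCoord
  split_ifs <;> fun_prop

theorem stdSimplex_eq_vertex {k : ℕ} {x : stdSimplex ℝ (Fin (k + 1))} {i : Fin (k + 1)}
    (h : x i = 1) : x = stdSimplex.vertex i := by
  have := stdSimplex_map_eq_of_injective (f := fun _ : Fin 1 => i)
    (Function.injective_of_subsingleton _) (stdSimplex.vertex 0) x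
    (fun j => by rw [h, Subsingleton.elim j 0]; simp [stdSimplex.vertex])
  rw [← this, stdSimplex.map_vertex]

theorem simplexPoint_zero (k : ℕ) (τ : ℕ → unitInterval) :
    simplexPoint k τ 0 = stdSimplex.vertex 0 := by
  apply stdSimplex_eq_vertex
  rw [simplexPoint_apply, pathCoord]
  split_ifs <;> simp [cumulativeCoord, vertexTime_zero]

/-- With last parameter 1 the final restart time is v_k = v_(k-1) + 1, when the last coordinate has
reached 1. For k = 0 the hypothesis is empty. -/
theorem simplexPoint_last (k : ℕ) (τ : ℕ → unitInterval) (h : ∀ i, i + 1 = k → τ i = 1) :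
    simplexPoint k τ (restartTime τ k) = stdSimplex.vertex (Fin.last k) := by
  apply stdSimplex_eq_vertex
  rw [simplexPoint_apply, pathCoord]
  cases k with
  | zero => simp [cumulativeCoord]
  | succ k =>
    rw [restartTime_succ_of_one (h k rfl)]
    simp [cumulativeCoord, vertexTime_succ, h k rfl]

theorem vertexTime_insert {τ τ' : ℕ → unitInterval} {j : ℕ} (h₁ : ∀ i < j, τ i = τ' i)
    (h₀ : τ j = 0) (h₂ : ∀ i, j ≤ i → τ (i + 1) = τ' i) :
    (∀ i ≤ j, vertexTime τ i = vertexTime τ' i) ∧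
      ∀ i, j ≤ i → vertexTime τ (i + 1) = vertexTime τ' i := by
  have h : ∀ i ≤ j, vertexTime τ i = vertexTime τ' i := fun i hi =>
    Finset.sum_congr rfl fun l hl => by rw [h₁ l ((Finset.mem_range.1 hl).trans_le hi)]
  refine ⟨h, fun i hi => ?_⟩
  induction i, hi using Nat.le_induction with
  | base => rw [vertexTime_succ, h j le_rfl, h₀]; simp
  | succ i hi ih => rw [vertexTime_succ, ih, h₂ i hi, vertexTime_succ]

theorem restartTime_congr {τ τ' : ℕ → unitInterval} {j : ℕ} (h : ∀ i < j, τ i = τ' i) :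
    ∀ i ≤ j, restartTime τ i = restartTime τ' i
  | 0, _ => rfl
  | i + 1, hi => by
    have : vertexTime τ (i + 1) = vertexTime τ' (i + 1) :=
      Finset.sum_congr rfl fun l hl => by rw [h l ((Finset.mem_range.1 hl).trans_le hi)]
    rw [restartTime, restartTime, restartTime_congr h i (by omega), this, h i hi]

theorem restartTime_insert {τ τ' : ℕ → unitInterval} {j : ℕ} (h₁ : ∀ i < j, τ i = τ' i)
    (h₀ : τ j = 0) (h₂ : ∀ i, j ≤ i → τ (i + 1) = τ' i) (i : ℕ) (hi : j ≤ i) :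
    restartTime τ (i + 1) = restartTime τ' i := by
  induction i, hi using Nat.le_induction with
  | base => rw [restartTime, h₀, restartTime_congr h₁ j le_rfl]; simp
  | succ i hi ih =>
    rw [restartTime, ih, h₂ i hi, (vertexTime_insert h₁ h₀ h₂).2 (i + 1) (by omega), restartTime]

/-- As τ_j = 0, the vertex times j and j + 1 coincide, so the barycentric coordinate j + 1 vanishes;
the others are those for τ'. -/
theorem simplexPoint_insert {τ τ' : ℕ → unitInterval} {k : ℕ} (j : Fin (k + 1))
    (h₁ : ∀ i < j.1, τ i = τ' i) (h₀ : τ j = 0) (h₂ : ∀ i, j.1 ≤ i → τ (i + 1) = τ' i) (x : ℝ) :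
    stdSimplex.map j.castSucc.succ.succAbove (simplexPoint (k + 1) τ' x) =
      simplexPoint (k + 2) τ x := by
  obtain ⟨hv₁, hv₂⟩ := vertexTime_insert h₁ h₀ h₂
  have hc₁ : ∀ i ≤ j.1 + 1, cumulativeCoord τ x i = cumulativeCoord τ' x i := by
    rintro (_ | i) hi
    · rfl
    · rw [cumulativeCoord, cumulativeCoord, hv₁ i (by omega)]
  have hc₂ : ∀ i, j.1 + 1 ≤ i → cumulativeCoord τ x (i + 1) = cumulativeCoord τ' x i := by
    rintro (_ | i) hi
    · omega
    · rw [cumulativeCoord, cumulativeCoord, hv₂ i (by omega)]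
  refine stdSimplex_map_eq_of_injective Fin.succAbove_right_injective _ _ fun i => ?_
  rw [simplexPoint_apply, simplexPoint_apply]
  by_cases hi : i.1 < j.1 + 1
  · have : (j.castSucc.succ.succAbove i).1 = i.1 := by
      rw [Fin.succAbove_of_castSucc_lt _ _ (by simp [Fin.lt_def]; omega)]; rfl
    rw [this, pathCoord, pathCoord, if_pos (by omega), if_pos (by omega), hc₁ i (by omega),
      hc₁ (i + 1) (by omega)]
  · have : (j.castSucc.succ.succAbove i).1 = i.1 + 1 := by
      rw [Fin.succAbove_of_le_castSucc _ _ (by simp [Fin.le_def]; omega)]; rfl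
    rw [this, pathCoord, pathCoord, hc₂ i (by omega), hc₂ (i + 1) (by omega)]
    simp

/-- Up to the time v_a, no coordinate beyond the index a has started to grow. -/
theorem simplexPoint_front {τ τ' : ℕ → unitInterval} {a m : ℕ} (hm : a + 1 ≤ m + 1)
    (h : ∀ i < a, τ i = τ' i) {x : ℝ} (hx : x ≤ vertexTime τ a) :
    stdSimplex.map (Fin.castLE hm) (simplexPoint a τ' x) = simplexPoint m τ x := by
  have hv : ∀ i ≤ a, vertexTime τ i = vertexTime τ' i := fun i hi =>
    Finset.sum_congr rfl fun l hl => by rw [h l ((Finset.mem_range.1 hl).trans_le hi)]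
  have hc : ∀ i ≤ a + 1, cumulativeCoord τ x i = cumulativeCoord τ' x i := by
    rintro (_ | i) hi
    · rfl
    · rw [cumulativeCoord, cumulativeCoord, hv i (by omega)]
  have h0 : cumulativeCoord τ x (a + 1) = 0 :=
    max_eq_left ((min_le_left _ _).trans (sub_nonpos.2 hx))
  refine stdSimplex_map_eq_of_injective (Fin.castLE_injective hm) _ _ fun i => ?_
  rw [simplexPoint_apply, simplexPoint_apply, pathCoord, pathCoord, Fin.val_castLE,
    hc i (by omega)]
  by_cases hi : i.1 < a
  · rw [if_pos hi, if_pos (by omega), hc (i + 1) (by omega)]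
  · have : i.1 = a := by omega
    rw [if_neg hi, this, h0, ite_self]

theorem vertexTime_add {τ τ' : ℕ → unitInterval} {a : ℕ} (h : ∀ i, τ (a + i) = τ' i) (i : ℕ) :
    vertexTime τ (a + i) = vertexTime τ a + vertexTime τ' i := by
  rw [vertexTime, Finset.sum_range_add]
  simp only [h]
  rfl

/-- From the time v_(a+1) = v_a + 1 on, the coordinates below the index a + 1 are exhausted, and the
later ones evolve as for τ' with time shifted by v_(a+1). -/
theorem simplexPoint_back {τ τ' : ℕ → unitInterval} {a k : ℕ} (h₁ : τ a = 1)
    (h : ∀ i, τ (a + 1 + i) = τ' i) {x : ℝ} (hx : 0 ≤ x) :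
    stdSimplex.map (fun i : Fin (k + 1) => (Fin.natAdd (a + 1) i : Fin (a + 1 + k + 1)))
      (simplexPoint k τ' x) = simplexPoint (a + 1 + k) τ (vertexTime τ (a + 1) + x) := by
  have hc : ∀ i, cumulativeCoord τ (vertexTime τ (a + 1) + x) (a + 1 + i) =
      cumulativeCoord τ' x i := by
    rintro (_ | i)
    · simp only [cumulativeCoord]
      rw [min_eq_right, max_eq_right zero_le_one]
      rw [vertexTime_succ, h₁, Set.Icc.coe_one]
      linarith
    · rw [← add_assoc, cumulativeCoord, cumulativeCoord, vertexTime_add h]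
      congr 2
      ring
  refine stdSimplex_map_eq_of_injective (fun i j hij => Fin.natAdd_injective _ _ hij) _ _
    fun i => ?_
  rw [simplexPoint_apply, simplexPoint_apply, pathCoord, pathCoord, Fin.val_natAdd, hc i,
    add_assoc (a + 1), hc (i + 1)]
  simp

/-- The recursion commutes with translations of time, and τ_a = 1 starts it afresh at v_(a+1). -/
theorem restartTime_add {τ τ' : ℕ → unitInterval} {a : ℕ} (h₁ : τ a = 1)
    (h : ∀ i, τ (a + 1 + i) = τ' i) :
    ∀ i, restartTime τ (a + 1 + i) = vertexTime τ (a + 1) + restartTime τ' i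
  | 0 => by rw [add_zero, restartTime_succ_of_one h₁]; simp [restartTime]
  | i + 1 => by
    rw [← add_assoc, restartTime, restartTime_add h₁ h i, h i, restartTime, add_assoc (a + 1),
      vertexTime_add h]
    ring

/-! ### Sequences of parameters under insertion of 0 and concatenation through 1 -/

/-- A finite sequence of parameters, continued by `1`. -/
def extendByOne {n : ℕ} (t : Fin n → unitInterval) (i : ℕ) : unitInterval :=
  if h : i < n then t ⟨i, h⟩ else 1

theorem extendByOne_of_le {n : ℕ} (t : Fin n → unitInterval) {i : ℕ} (h : n ≤ i) :
    extendByOne t i = 1 :=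
  dif_neg h.not_gt

theorem extendByOne_val {n : ℕ} (t : Fin n → unitInterval) (i : Fin n) : extendByOne t i = t i :=
  dif_pos i.2

theorem continuous_extendByOne (n : ℕ) :
    Continuous (extendByOne : (Fin n → unitInterval) → ℕ → unitInterval) := by
  refine continuous_pi fun i => ?_
  unfold extendByOne
  split_ifs <;> fun_prop

section InsertNth

variable {n : ℕ} (j : Fin (n + 1)) (s : Fin n → unitInterval)

theorem extendByOne_insertNth_of_lt (i : ℕ) (hi : i < j.1) :
    extendByOne (j.insertNth (α := fun _ => unitInterval) 0 s) i = extendByOne s i := by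
  have hn : i < n := by omega
  have h := extendByOne_val (j.insertNth (α := fun _ => unitInterval) 0 s) (j.succAbove ⟨i, hn⟩)
  rw [Fin.insertNth_apply_succAbove, Fin.succAbove_of_castSucc_lt _ _ (by simpa [Fin.lt_def])] at h
  exact h.trans (extendByOne_val s ⟨i, hn⟩).symm

theorem extendByOne_insertNth_self :
    extendByOne (j.insertNth (α := fun _ => unitInterval) 0 s) j = 0 := by
  rw [extendByOne_val, Fin.insertNth_apply_same]

theorem extendByOne_insertNth_succ (i : ℕ) (hi : j.1 ≤ i) :
    extendByOne (j.insertNth (α := fun _ => unitInterval) 0 s) (i + 1) = extendByOne s i := by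
  by_cases hn : i < n
  · have h := extendByOne_val (j.insertNth (α := fun _ => unitInterval) 0 s) (j.succAbove ⟨i, hn⟩)
    rw [Fin.insertNth_apply_succAbove,
      Fin.succAbove_of_le_castSucc _ _ (by simpa [Fin.le_def])] at h
    exact h.trans (extendByOne_val s ⟨i, hn⟩).symm
  · rw [extendByOne_of_le _ (by omega), extendByOne_of_le _ (by omega)]

end InsertNth

section Append

variable {a b : ℕ} (s : Fin a → unitInterval) (u : Fin b → unitInterval)

/-- At the index a, the separating entry 1 agrees with the default value that continues `s`. -/
theorem extendByOne_append_of_lt (i : ℕ) (hi : i < a + 1) :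
    extendByOne (Fin.append (Fin.snoc (α := fun _ => unitInterval) s 1) u) i = extendByOne s i := by
  have h := extendByOne_val (Fin.append (Fin.snoc (α := fun _ => unitInterval) s 1) u)
    (Fin.castAdd b ⟨i, hi⟩)
  rw [Fin.append_left] at h
  refine h.trans ?_
  by_cases hia : i < a
  · exact (Fin.snoc_castSucc (α := fun _ => unitInterval) 1 s ⟨i, hia⟩).trans
      (extendByOne_val s ⟨i, hia⟩).symm
  · obtain rfl : i = a := by omega
    exact (Fin.snoc_last (α := fun _ => unitInterval) 1 s).trans (extendByOne_of_le s le_rfl).symm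

theorem extendByOne_append_add (i : ℕ) :
    extendByOne (Fin.append (Fin.snoc (α := fun _ => unitInterval) s 1) u) (a + 1 + i) =
      extendByOne u i := by
  by_cases hi : i < b
  · have h := extendByOne_val (Fin.append (Fin.snoc (α := fun _ => unitInterval) s 1) u)
      (Fin.natAdd (a + 1) ⟨i, hi⟩)
    rw [Fin.append_right] at h
    exact h.trans (extendByOne_val u ⟨i, hi⟩).symm
  · rw [extendByOne_of_le _ (by omega), extendByOne_of_le _ (by omega)]

end Append

end SimplexPath

/-! ### Paths in singular simplices -/

namespace SingSimplex

variable {B : Type v} [TopologicalSpace B]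

/-- The path with the parameters `τ` from the first to the last vertex of `σ`. -/
noncomputable def path {k : ℕ} (σ : SingSimplex B k) (τ : ℕ → unitInterval) : C(ℝ, B) :=
  ⟨fun x => σ (simplexPoint k τ x),
    σ.continuous.comp ((continuous_simplexPoint k).comp (Continuous.prodMk_right τ))⟩

theorem continuous_path {k : ℕ} (σ : SingSimplex B k) : Continuous σ.path :=
  ContinuousMap.continuous_of_continuous_uncurry _ (σ.continuous.comp (continuous_simplexPoint k))

theorem path_zero {k : ℕ} (σ : SingSimplex B k) (τ : ℕ → unitInterval) : σ.path τ 0 = σ.vertex 0 :=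
  congrArg σ (simplexPoint_zero k τ)

/-- The k - 1 parameters are followed by the default value 1 at the index k - 1, which makes the
path end at the last vertex. -/
theorem path_last {k : ℕ} (σ : SingSimplex B k) (t : Fin (k - 1) → unitInterval) :
    σ.path (extendByOne t) (restartTime (extendByOne t) k) = σ.vertex (Fin.last k) :=
  congrArg σ (simplexPoint_last k _ fun i hi => extendByOne_of_le t (by omega))

end SingSimplex

/-! ### The representation up to homotopy and its relations -/

section Representation

variable {E : Type u} {B : Type v} [TopologicalSpace E] [TopologicalSpace B] {p : C(E, B)}

namespace EndpointLifting

variable (L : EndpointLifting p)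

/-- The transport along the path with the parameters `t`, restarted at the restart times. -/
noncomputable def simplexTransport {k : ℕ} (σ : SingSimplex B k) :
    C((Fin (k - 1) → unitInterval) × Fibre p (σ.vertex 0), Fibre p (σ.vertex (Fin.last k))) :=
  ⟨fun z => L.fibreChain (σ.path (extendByOne z.1)) (restartTime (extendByOne z.1)) k
      (σ.path_zero _).symm (σ.path_last z.1) z.2,
    Continuous.subtype_mk (L.continuous_chain
      (σ.continuous_path.comp ((continuous_extendByOne _).comp continuous_fst))
      (fun i => (continuous_restartTime i).comp ((continuous_extendByOne _).comp continuous_fst))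
      (continuous_subtype_val.comp continuous_snd)
      (fun z => z.2.2.trans (σ.path_zero _).symm) k) _⟩

theorem coe_simplexTransport {k : ℕ} (σ : SingSimplex B k) (t : Fin (k - 1) → unitInterval)
    (e : Fibre p (σ.vertex 0)) : (L.simplexTransport σ (t, e) : E) =
      L.chain (σ.path (extendByOne t)) (restartTime (extendByOne t)) k e := rfl

theorem simplexTransport_face {n : ℕ} (σ : SingSimplex B (n + 2)) (j : Fin (n + 1))
    (s : Fin n → unitInterval) (e : Fibre p (σ.vertex 0)) :
    (L.simplexTransport σ (j.insertNth (α := fun _ => unitInterval) 0 s, e) : E) =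
      L.simplexTransport (σ.face j.castSucc.succ)
        (s, e.cast (σ.vertex_zero_face j.castSucc)) := by
  rw [coe_simplexTransport, coe_simplexTransport]
  have h₁ := extendByOne_insertNth_of_lt j s
  have h₀ := extendByOne_insertNth_self j s
  have h₂ := extendByOne_insertNth_succ j s
  have hpath : σ.path (extendByOne (j.insertNth (α := fun _ => unitInterval) 0 s)) =
      (σ.face j.castSucc.succ).path (extendByOne s) := by
    ext x
    exact congrArg σ (simplexPoint_insert j h₁ h₀ h₂ x).symm
  refine (L.chain_skip _ (restartTime_congr h₁) (restartTime_insert h₁ h₀ h₂) e.1 (n + 1)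
    (by omega)).trans ?_
  exact congrArg (fun γ => L.chain γ (restartTime (extendByOne s)) (n + 1) e.1) hpath

theorem simplexTransport_comp {a b : ℕ} (σ : SingSimplex B ((a + 1) + (b + 1)))
    (s : Fin a → unitInterval) (u : Fin b → unitInterval) (e : Fibre p (σ.vertex 0)) :
    (L.simplexTransport σ (Fin.append (Fin.snoc (α := fun _ => unitInterval) s 1) u, e) : E) =
      L.simplexTransport (σ.back (a + 1) (b + 1))
        (u, (L.simplexTransport (σ.front (a + 1) (b + 1))
          (s, e.cast (σ.vertex_zero_front (a + 1) (b + 1)))).cast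
            (σ.vertex_last_front (a + 1) (b + 1))) := by
  have hf := extendByOne_append_of_lt s u
  have hb := extendByOne_append_add s u
  have h₁ := (hf a (Nat.lt_succ_self a)).trans (extendByOne_of_le s le_rfl)
  refine (coe_simplexTransport L σ _ e).trans ?_
  rw [coe_simplexTransport]
  set τ := extendByOne (Fin.append (Fin.snoc (α := fun _ => unitInterval) s 1) u)
  rw [L.chain_add]
  have hfront : L.chain (σ.path τ) (restartTime τ) (a + 1) e.1 =
      (L.simplexTransport (σ.front (a + 1) (b + 1))
          (s, e.cast (σ.vertex_zero_front (a + 1) (b + 1))) : E) := by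
    refine L.chain_congr e.1 (a + 1) (fun i hi => ?_) (fun i hi x hx => ?_)
    · rw [restartTime_congr hf i (by omega), restartTime_congr hf (i + 1) (by omega)]
    · have hi' : restartTime τ i ≤ restartTime τ (i + 1) := restartTime_mono τ i.le_succ
      rw [Set.uIcc_of_le (sub_nonneg.2 hi')] at hx
      -- The first a + 1 steps end no later than v_(a+1), and until then the path stays in the front
      -- face.
      have hle : restartTime τ i + x ≤ vertexTime τ (a + 1) := by
        have := restartTime_mono τ (show i + 1 ≤ a + 1 by omega)
        have := restartTime_le_vertexTime τ (a + 1)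
        linarith [hx.2]
      refine (congrArg σ (simplexPoint_front (by omega) hf hle).symm).trans ?_
      rw [restartTime_congr hf i (by omega)]
      rfl
  rw [hfront]
  refine L.chain_congr _ (b + 1) (fun i _ => ?_) (fun i _ x hx => ?_)
  · rw [restartTime_add h₁ hb, restartTime_add h₁ hb]
    exact add_sub_add_left_eq_sub _ _ _
  · have hi' : restartTime τ (a + 1 + i) ≤ restartTime τ (a + 1 + (i + 1)) :=
      restartTime_mono τ (by omega)
    -- The remaining steps only run forward from the vertex a + 1, so the shifted time is
    -- nonnegative and the path lies in the back face.
    replace hx := (Set.uIcc_of_le (sub_nonneg.2 hi')).subset hx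
    have h0 : 0 ≤ restartTime (extendByOne u) i + x :=
      add_nonneg (restartTime_mono (extendByOne u) i.zero_le) hx.1
    rw [restartTime_add h₁ hb, add_assoc (vertexTime τ (a + 1))]
    exact congrArg σ (simplexPoint_back h₁ hb h0).symm

end EndpointLifting

end Representation

theorem theorem3 {E : Type u} {B : Type v} [TopologicalSpace E] [TopologicalSpace B]
    (p : C(E, B)) (hp : IsHurewiczFibration p) : Nonempty (RepUpToHomotopy p) := by
  obtain ⟨L⟩ := hp.nonempty_endpointLifting
  exact ⟨{
    θ := fun _ σ => L.simplexTransport σ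
    -- For k = 0 the chain has no steps.
    θ_zero := fun _ _ _ => rfl
    homotopyEquivalence := fun k σ t => L.isHomotopyEquivalence_fibreChain
      (σ.path (extendByOne t)) (restartTime (extendByOne t)) k (σ.path_zero _).symm
      (σ.path_last t)
    face_rel := fun _ σ j s e => L.simplexTransport_face σ j s e
    comp_rel := fun _ _ σ s u e => L.simplexTransport_comp σ s u e }⟩
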